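/- Let $(N^{m+1},h)$ be a smooth Riemannian manifold with non-positive Ricci curvature, $\mathrm{Ric}^N(u,u)\le 0$ for all $u\in TN$, let $(M^m,g)$ be a smooth $m$-dimensional Riemannian manifold, and let $\phi:(M,g)\to(N,h)$ be a smooth isometric immersion (so $M$ is a hypersurface in $N$). Let $B$ be its second fundamental form and $\mathbf H=\frac1m\sum_{i=1}^m B(e_i,e_i)$ its mean curvature vector field, where $\{e_i\}$ denotes a local orthonormal frame of $M$. Suppose that $M$ is a non-negative biminimal hypersurface, that is, for some real constant $\lambda\ge 0$, $$\Big[-\Delta^{\phi}\mathbf H-\sum_{i=1}^m R^N(\mathbf H,d\phi(e_i))\,d\phi(e_i)\Big]^{\perp}+\lambda\,\mathbf H=0\quad\text{on } M .$$ Here $\nabla^\phi$ is the pull-back by $\phi$ of the Levi-Civita connection of $N$, $\nabla$ is the Levi-Civita connection of $M$, $\Delta^\phi V=\sum_i(\nabla^\phi_{e_i}\nabla^\phi_{e_i}V-\nabla^\phi_{\nabla_{e_i}e_i}V)$ for vector fields $V$ along $\phi$, $R^N(X,Y)Z=\nabla^N_X\nabla^N_YZ-\nabla^N_Y\nabla^N_XZ-\nabla^N_{[X,Y]}Z$,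 $\mathrm{Ric}^N(u,u)=\sum_a h(R^N(E_a,u)u,E_a)$ for an orthonormal basis $\{E_a\}$ of the tangent space of $N$, and $[\cdot]^\perp$ is the component normal to $d\phi(TM)$. Then $|\mathbf H|^2$ is a smooth function on $M$ and $$\Delta|\mathbf H|^2\ \ge\ 2m\,|\mathbf H|^4\quad\text{at every point of } M,$$ where $\Delta$ is the (non-positive) Laplace–Beltrami operator of $(M,g)$. -/

import Mathlib

open scoped Manifold ContDiff Bundle

noncomputable section

namespace RiemLocal

/-! ### Coordinate expressions

Here `E` and `F` play the role of coordinate spaces. `g` and `G` are metrics given by their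
coordinate expressions, `f` is the coordinate expression of a map and `V` that of a vector field
along it. -/

variable {E : Type*} [NormedAddCommGroup E] [NormedSpace ℝ E]
  {F : Type*} [NormedAddCommGroup F] [NormedSpace ℝ F]

/-- Christoffel symbols of the Levi-Civita connection of the metric `g`, as a vector: at the point
`y`, `christoffel g y u v` is the vector `Γ(u, v)` with
`g (Γ(u, v), w) = (1/2) (D_u g (v, w) + D_v g (u, w) - D_w g (u, v))` for all `w`.
It is the value at `y` of `∇_u v` for constant vector fields `u` and `v`. -/
def christoffel (g : E → E →L[ℝ] E →L[ℝ] ℝ) (y u v : E) : E :=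
  (g y).inverse ((1 / 2 : ℝ) •
    (fderiv ℝ g y u v + fderiv ℝ g y v u - ((fderiv ℝ g y).flip u).flip v))

/-- The curvature `R(u, v) w = ∇_u ∇_v w - ∇_v ∇_u w` of the metric `g` at `y`, computed on constant
vector fields `u`, `v`, `w` (whose Lie brackets vanish). -/
def curvature (g : E → E →L[ℝ] E →L[ℝ] ℝ) (y u v w : E) : E :=
  fderiv ℝ (fun z ↦ christoffel g z v w) y u - fderiv ℝ (fun z ↦ christoffel g z u w) y v
    + christoffel g y u (christoffel g y v w) - christoffel g y v (christoffel g y u w)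

/-- The covariant derivative `∇^f_u V` at `y` of a vector field `V` along the map `f : E → F`, for
the connection pulled back by `f` from the Levi-Civita connection of the metric `G` of the
target. -/
def covDerivAlong (G : F → F →L[ℝ] F →L[ℝ] ℝ) (f V : E → F) (y u : E) : F :=
  fderiv ℝ V y u + christoffel G (f y) (fderiv ℝ f y u) (V y)

/-- The second covariant derivative `∇^f_u ∇^f_v V - ∇^f_{∇_u v} V` at `y` of a vector field `V`
along `f` (for constant vector fields `u` and `v` on the source). -/
def covDerivAlong₂ (g : E → E →L[ℝ] E →L[ℝ] ℝ) (G : F → F →L[ℝ] F →L[ℝ] ℝ) (f V : E → F)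
    (y u v : E) : F :=
  covDerivAlong G f (fun z ↦ covDerivAlong G f V z v) y u
    - covDerivAlong G f V y (christoffel g y u v)

/-- The second fundamental form `∇^f_u (df v) - df (∇_u v)` at `y` (Gauss formula). -/
def secondForm (g : E → E →L[ℝ] E →L[ℝ] ℝ) (G : F → F →L[ℝ] F →L[ℝ] ℝ) (f : E → F)
    (y u v : E) : F :=
  covDerivAlong G f (fun z ↦ fderiv ℝ f z v) y u - fderiv ℝ f y (christoffel g y u v)

/-- The Hessian `u (v (r)) - (∇_u v) (r)` at `y` of a real function `r`. -/
def hessian (g : E → E →L[ℝ] E →L[ℝ] ℝ) (r : E → ℝ) (y u v : E) : ℝ :=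
  fderiv ℝ (fun z ↦ fderiv ℝ r z v) y u - fderiv ℝ r y (christoffel g y u v)

end RiemLocal

namespace Riem

/-! ### Riemannian manifolds and maps between them

Every tensor at a point `x` is computed in the preferred chart `extChartAt I x` at `x`. The
derivative at `x` of that chart is the identity of `TangentSpace I x = E`, so that tangent vectors
at `x` are their own coordinates. -/

variable {E : Type*} [NormedAddCommGroup E] [NormedSpace ℝ E] [FiniteDimensional ℝ E]
  {H : Type*} [TopologicalSpace H] (I : ModelWithCorners ℝ E H)
  {M : Type*} [TopologicalSpace M] [ChartedSpace H M] [IsManifold I ∞ M]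
  [Bundle.RiemannianBundle (fun x : M ↦ TangentSpace I x)]
  {F : Type*} [NormedAddCommGroup F] [NormedSpace ℝ F] [FiniteDimensional ℝ F]
  {H' : Type*} [TopologicalSpace H'] (J : ModelWithCorners ℝ F H')
  {N : Type*} [TopologicalSpace N] [ChartedSpace H' N] [IsManifold J ∞ N]
  [Bundle.RiemannianBundle (fun p : N ↦ TangentSpace J p)]

instance instFiniteDimensionalTangentSpace (x : M) : FiniteDimensional ℝ (TangentSpace I x) :=
  inferInstanceAs (FiniteDimensional ℝ E)

/-- The coordinate expression of the Riemannian metric of `M` in the chart at `x`. -/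
def metricInChart (x : M) (y : E) : E →L[ℝ] E →L[ℝ] ℝ :=
  let D : E →L[ℝ] TangentSpace I ((extChartAt I x).symm y) :=
    mfderiv 𝓘(ℝ, E) I (extChartAt I x).symm y
  (innerSL ℝ : TangentSpace I ((extChartAt I x).symm y) →L[ℝ] _ →L[ℝ] ℝ).bilinearComp D D

/-- The Riemann curvature tensor `R(u, v) w` at `x`, with the sign
`R(X, Y) Z = ∇_X ∇_Y Z - ∇_Y ∇_X Z - ∇_[X, Y] Z`. -/
def curvature (x : M) (u v w : TangentSpace I x) : TangentSpace I x :=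
  RiemLocal.curvature (E := E) (metricInChart I x) (extChartAt I x x) u v w

/-- The Ricci curvature `Ric(u, v) = ∑ a, ⟨R(e_a, u) v, e_a⟩` at `x`, for an orthonormal basis
`e_a` of the tangent space. -/
def ricci (x : M) (u v : TangentSpace I x) : ℝ :=
  ∑ a, inner ℝ (curvature I x (stdOrthonormalBasis ℝ (TangentSpace I x) a) u v)
    (stdOrthonormalBasis ℝ (TangentSpace I x) a)

variable (M) in
/-- The Ricci curvature is non-positive. -/
def RicciNonpos : Prop :=
  ∀ (x : M) (u : TangentSpace I x), ricci I x u u ≤ 0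

/-- The (non-positive) Laplace-Beltrami operator `Δ r = ∑ i, Hess r (e_i, e_i)` on functions. -/
def laplacian (r : M → ℝ) (x : M) : ℝ :=
  ∑ i, RiemLocal.hessian (E := E) (metricInChart I x) (r ∘ (extChartAt I x).symm) (extChartAt I x x)
    (stdOrthonormalBasis ℝ (TangentSpace I x) i) (stdOrthonormalBasis ℝ (TangentSpace I x) i)

/-- `φ` is a smooth isometric immersion (it is an immersion because its derivative preserves
norms). -/
structure IsIsometricImmersion (φ : M → N) : Prop where
  contMDiff : ContMDiff I J ∞ φ
  inner_mfderiv : ∀ (x : M) (u v : TangentSpace I x),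
    inner ℝ (mfderiv I J φ x u) (mfderiv I J φ x v) = inner ℝ u v

/-- The coordinate expression, in the charts at `x` and `φ x`, of a vector field `V` along `φ`. -/
def sectionInCharts (φ : M → N) (V : (x : M) → TangentSpace J (φ x)) (x : M) (y : E) : F :=
  mfderiv J 𝓘(ℝ, F) (extChartAt J (φ x)) (φ ((extChartAt I x).symm y))
    (V ((extChartAt I x).symm y))

/-- The second fundamental form `B` of `φ` at `x`. -/
def secondForm (φ : M → N) (x : M) (u v : TangentSpace I x) : TangentSpace J (φ x) :=
  RiemLocal.secondForm (E := E) (F := F) (metricInChart I x) (metricInChart J (φ x)) (writtenInExtChartAt I J x φ)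
    (extChartAt I x x) u v

/-- The mean curvature vector field `𝐇 = (1 / m) ∑ i, B(e_i, e_i)`, where `m` is the dimension
of `M`. -/
def meanCurvature (φ : M → N) (x : M) : TangentSpace J (φ x) :=
  (Module.finrank ℝ E : ℝ)⁻¹ • ∑ i, secondForm I J φ x
    (stdOrthonormalBasis ℝ (TangentSpace I x) i) (stdOrthonormalBasis ℝ (TangentSpace I x) i)

/-- The rough Laplacian `Δ^φ V = ∑ i, (∇^φ_{e_i} ∇^φ_{e_i} V - ∇^φ_{∇_{e_i} e_i} V)` on vector
fields along `φ`. -/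
def roughLaplacian (φ : M → N) (V : (x : M) → TangentSpace J (φ x)) (x : M) :
    TangentSpace J (φ x) :=
  ∑ i, RiemLocal.covDerivAlong₂ (E := E) (F := F) (metricInChart I x) (metricInChart J (φ x))
    (writtenInExtChartAt I J x φ) (sectionInCharts I J φ V x) (extChartAt I x x)
    (stdOrthonormalBasis ℝ (TangentSpace I x) i) (stdOrthonormalBasis ℝ (TangentSpace I x) i)

/-- The curvature term `∑ i, R^N(V, dφ e_i) dφ e_i`. -/
def curvatureTrace (φ : M → N) (V : (x : M) → TangentSpace J (φ x)) (x : M) :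
    TangentSpace J (φ x) :=
  ∑ i, curvature J (φ x) (V x)
    (mfderiv I J φ x (stdOrthonormalBasis ℝ (TangentSpace I x) i))
    (mfderiv I J φ x (stdOrthonormalBasis ℝ (TangentSpace I x) i))

/-- The normal component of a vector of `T_{φ x} N`. -/
def normalPart (φ : M → N) (x : M) (w : TangentSpace J (φ x)) : TangentSpace J (φ x) :=
  (mfderiv I J φ x).rangeᗮ.starProjection w

/-- `M` is a biminimal submanifold of `N`, with parameter `lam`, through the isometric immersion
`φ`: one has `[-Δ^φ 𝐇 - ∑ i, R^N(𝐇, dφ e_i) dφ e_i]^⊥ + lam • 𝐇 = 0`. -/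
structure IsBiminimal (φ : M → N) (lam : ℝ) : Prop extends IsIsometricImmersion I J φ where
  eq_zero : ∀ x : M,
    normalPart I J φ x
      (-roughLaplacian I J φ (meanCurvature I J φ) x
        - curvatureTrace I J φ (meanCurvature I J φ) x)
      + lam • meanCurvature I J φ x = 0

end Riem

end

/-!
Taking the inner product of the biminimality equation with `𝐇`, which is normal, turns it into
`⟪Δ^φ 𝐇, 𝐇⟫ = λ|𝐇|² - ∑ i, ⟪R^N(𝐇, dφ e_i) dφ e_i, 𝐇⟫`. On a hypersurface, the `dφ e_i` together
with the unit normal in the direction of `𝐇` form an orthonormal basis, and the normal contributes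
nothing to the Ricci trace, so the last sum is `Ric^N(𝐇, 𝐇)`. The Bochner formula
`Δ|𝐇|² = 2⟪Δ^φ 𝐇, 𝐇⟫ + 2 ∑ i, |∇^φ_{e_i} 𝐇|²` leaves the gradient term, which is at least `m|𝐇|⁴`:
by the Weingarten formula `∑ i, ⟪∇^φ_{e_i} 𝐇, dφ e_i⟫ = -∑ i, ⟪𝐇, B(e_i, e_i)⟫ = -m|𝐇|²`, and one
applies the Cauchy–Schwarz inequality.

The second fundamental form at `p` is defined through the charts at `p` and `φ p`, which change
with `p`, so the smoothness of `𝐇` is not immediate. By the chain rule for second fundamental forms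
it may be computed in fixed charts, because a change of coordinates is an isometry between the
metrics read in the two charts and therefore has vanishing second fundamental form.
-/

namespace RiemLocal

set_option maxSynthPendingDepth 3

open Filter Topology Module

section Calculus

variable {E : Type*} [NormedAddCommGroup E] [NormedSpace ℝ E]
  {F : Type*} [NormedAddCommGroup F] [NormedSpace ℝ F]
  {X : Type*} [NormedAddCommGroup X] [NormedSpace ℝ X]

theorem contDiffAt_clm_of_forall_apply [FiniteDimensional ℝ E] {n : WithTop ℕ∞} {A : X → E →L[ℝ] F}
    {x : X} (h : ∀ v, ContDiffAt ℝ n (fun z ↦ A z v) x) : ContDiffAt ℝ n A x := by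
  let b := finBasis ℝ E
  have hA : A = fun z ↦ ∑ i, (b.coord i).toContinuousLinearMap.smulRight (A z (b i)) := by
    ext z v
    conv_lhs => rw [← b.sum_repr v, map_sum]
    simp
  rw [hA]
  exact ContDiffAt.sum fun i _ ↦ contDiffAt_const.smulRight (h (b i))

theorem fderiv_apply_const {A : X → E →L[ℝ] F} {x : X} (hA : DifferentiableAt ℝ A x) (v : E)
    (u : X) : fderiv ℝ (fun z ↦ A z v) x u = fderiv ℝ A x u v := by
  simp [fderiv_clm_apply hA (differentiableAt_const v)]

theorem fderiv_apply_apply {A : X → E →L[ℝ] E →L[ℝ] ℝ} {V W : X → E} {x : X}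
    (hA : DifferentiableAt ℝ A x) (hV : DifferentiableAt ℝ V x) (hW : DifferentiableAt ℝ W x)
    (u : X) :
    fderiv ℝ (fun z ↦ A z (V z) (W z)) x u
      = fderiv ℝ A x u (V x) (W x) + A x (fderiv ℝ V x u) (W x) + A x (V x) (fderiv ℝ W x u) := by
  simp [fderiv_clm_apply (hA.clm_apply hV) hW, fderiv_clm_apply hA hV]
  ring

theorem differentiableAt_fderiv {f : E → F} {y : E} (hf : ContDiffAt ℝ 2 f y) :
    DifferentiableAt ℝ (fderiv ℝ f) y :=
  (hf.fderiv_right (m := 1) (by norm_num)).differentiableAt one_ne_zero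

theorem fderiv_fderiv_apply {f : E → F} {y : E} (hf : ContDiffAt ℝ 2 f y) (u v : E) :
    fderiv ℝ (fun z ↦ fderiv ℝ f z v) y u = fderiv ℝ (fderiv ℝ f) y u v :=
  fderiv_apply_const (differentiableAt_fderiv hf) v u

theorem fderiv_fderiv_comm {f : E → F} {y : E} (hf : ContDiffAt ℝ 2 f y) (u v : E) :
    fderiv ℝ (fderiv ℝ f) y u v = fderiv ℝ (fderiv ℝ f) y v u :=
  (hf.isSymmSndFDerivAt (by simp)).eq u v

theorem fderiv_fderiv_comp {f : E → F} {s : F → X} {y : E} (hs : ContDiffAt ℝ 2 s (f y))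
    (hf : ContDiffAt ℝ 2 f y) (u v : E) :
    fderiv ℝ (fderiv ℝ (s ∘ f)) y u v
      = fderiv ℝ (fderiv ℝ s) (f y) (fderiv ℝ f y u) (fderiv ℝ f y v)
        + fderiv ℝ s (f y) (fderiv ℝ (fderiv ℝ f) y u v) := by
  have hcomp : fderiv ℝ (s ∘ f) =ᶠ[𝓝 y] fun z ↦ (fderiv ℝ s (f z)).comp (fderiv ℝ f z) := by
    filter_upwards [hf.continuousAt.eventually (hs.eventually (by simp)), hf.eventually (by simp)]
      with z hsz hfz
    exact fderiv_comp z (hsz.differentiableAt two_ne_zero) (hfz.differentiableAt two_ne_zero)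
  have hs' := differentiableAt_fderiv hs
  have hf₁ := hf.differentiableAt two_ne_zero
  have hsf : DifferentiableAt ℝ (fun z ↦ fderiv ℝ s (f z)) y := hs'.comp y hf₁
  have hDsf : fderiv ℝ (fun z ↦ fderiv ℝ s (f z)) y u
      = fderiv ℝ (fderiv ℝ s) (f y) (fderiv ℝ f y u) :=
    DFunLike.congr_fun (fderiv_comp y hs' hf₁) u
  rw [hcomp.fderiv_eq, fderiv_clm_comp hsf (differentiableAt_fderiv hf)]
  simp [hDsf, add_comm]

end Calculus

variable {E : Type*} [NormedAddCommGroup E] [NormedSpace ℝ E]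
  {F : Type*} [NormedAddCommGroup F] [NormedSpace ℝ F]
  {X : Type*} [NormedAddCommGroup X] [NormedSpace ℝ X]
  {g : E → E →L[ℝ] E →L[ℝ] ℝ} {G : F → F →L[ℝ] F →L[ℝ] ℝ} {f f₀ : E → F} {y : E}

/-- The Christoffel symbols of `g` at `y` as a bilinear map. -/
noncomputable def christoffelBilin (g : E → E →L[ℝ] E →L[ℝ] ℝ) (y : E) : E →L[ℝ] E →L[ℝ] E :=
  (1 / 2 : ℝ) • ContinuousLinearMap.compL ℝ E (E →L[ℝ] ℝ) E (g y).inverse ∘L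
    (fderiv ℝ g y + (fderiv ℝ g y).flip -
      (ContinuousLinearMap.flipₗᵢ ℝ E E ℝ : (E →L[ℝ] E →L[ℝ] ℝ) →L[ℝ] E →L[ℝ] E →L[ℝ] ℝ) ∘L
        (fderiv ℝ g y).flip)

theorem christoffelBilin_apply (u v : E) : christoffelBilin g y u v = christoffel g y u v := by
  simp [christoffelBilin, christoffel]

/-- Near `y`, the field of bilinear forms `g` is a Riemannian metric of class `C²`. -/
structure IsMetricNear (g : E → E →L[ℝ] E →L[ℝ] ℝ) (y : E) : Prop where
  contDiffAt : ContDiffAt ℝ 2 g y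
  eventually_symm : ∀ᶠ z in 𝓝 y, ∀ u v, g z u v = g z v u
  eventually_pos : ∀ᶠ z in 𝓝 y, ∀ u ≠ 0, 0 < g z u u

/-- Near `y`, the map `f` preserves the metrics `g` and `G`. -/
def IsIsometricNear (g : E → E →L[ℝ] E →L[ℝ] ℝ) (G : F → F →L[ℝ] F →L[ℝ] ℝ) (f : E → F)
    (y : E) : Prop :=
  ∀ᶠ z in 𝓝 y, ∀ u v, G (f z) (fderiv ℝ f z u) (fderiv ℝ f z v) = g z u v

namespace IsMetricNear

theorem eventually (hg : IsMetricNear g y) : ∀ᶠ z in 𝓝 y, IsMetricNear g z := by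
  filter_upwards [hg.contDiffAt.eventually (by simp), hg.eventually_symm.eventually_nhds,
    hg.eventually_pos.eventually_nhds] with z hsmooth hsymm hpos
  exact ⟨hsmooth, hsymm, hpos⟩

theorem symm (hg : IsMetricNear g y) (u v : E) : g y u v = g y v u :=
  hg.eventually_symm.self_of_nhds u v

theorem differentiableAt (hg : IsMetricNear g y) : DifferentiableAt ℝ g y :=
  hg.contDiffAt.differentiableAt two_ne_zero

theorem eq_of_forall_apply_eq (hg : IsMetricNear g y) {a b : E} (h : ∀ w, g y a w = g y b w) :
    a = b := by
  by_contra hne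
  have hpos := hg.eventually_pos.self_of_nhds _ (sub_ne_zero.2 hne)
  simp [h] at hpos

theorem fderiv_comm (hg : IsMetricNear g y) (u v w : E) :
    fderiv ℝ g y u v w = fderiv ℝ g y u w v := by
  have hcomm : (fun z ↦ g z v w) =ᶠ[𝓝 y] fun z ↦ g z w v :=
    hg.eventually_symm.mono fun z hz ↦ hz v w
  have happly (a b : E) : fderiv ℝ (fun z ↦ g z a b) y u = fderiv ℝ g y u a b := by
    simp [fderiv_apply_apply hg.differentiableAt (differentiableAt_const a)
      (differentiableAt_const b)]
  rw [← happly, ← happly, hcomm.fderiv_eq]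

variable [FiniteDimensional ℝ E]

theorem isInvertible (hg : IsMetricNear g y) : (g y).IsInvertible := by
  have hinj : Function.Injective (g y : E →ₗ[ℝ] (E →L[ℝ] ℝ)) := fun a b hab ↦
    hg.eq_of_forall_apply_eq fun w ↦ congrArg (· w) hab
  have hdim : finrank ℝ E = finrank ℝ (E →L[ℝ] ℝ) := by
    rw [← Subspace.dual_finrank_eq]
    exact LinearMap.toContinuousLinearMap.finrank_eq
  exact ⟨(LinearMap.linearEquivOfInjective _ hinj hdim).toContinuousLinearEquiv, rfl⟩

theorem apply_inverse (hg : IsMetricNear g y) (ℓ : E →L[ℝ] ℝ) (w : E) :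
    g y ((g y).inverse ℓ) w = ℓ w := by
  rw [hg.isInvertible.self_apply_inverse]

theorem apply_christoffel (hg : IsMetricNear g y) (u v w : E) :
    g y (christoffel g y u v) w
      = (1 / 2 : ℝ) * (fderiv ℝ g y u v w + fderiv ℝ g y v u w - fderiv ℝ g y w u v) := by
  simp [christoffel, hg.apply_inverse]

theorem christoffel_comm (hg : IsMetricNear g y) (u v : E) :
    christoffel g y u v = christoffel g y v u :=
  hg.eq_of_forall_apply_eq fun w ↦ by
    rw [hg.apply_christoffel, hg.apply_christoffel, hg.fderiv_comm w u v]
    ring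

theorem fderiv_apply (hg : IsMetricNear g y) (u v w : E) :
    fderiv ℝ g y u v w = g y (christoffel g y u v) w + g y v (christoffel g y u w) := by
  rw [hg.symm v, hg.apply_christoffel, hg.apply_christoffel, hg.fderiv_comm u w v]
  ring

theorem contDiffAt_inverse {n : WithTop ℕ∞} (hg : IsMetricNear g y) (hn : ContDiffAt ℝ n g y) :
    ContDiffAt ℝ n (fun z ↦ (g z).inverse) y :=
  have := FiniteDimensional.complete ℝ E
  hg.isInvertible.contDiffAt_map_inverse.comp y hn

theorem contDiffAt_christoffelBilin {n k : WithTop ℕ∞} (hg : IsMetricNear g y)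
    (hk : ContDiffAt ℝ k g y) (hnk : n + 1 ≤ k) : ContDiffAt ℝ n (christoffelBilin g) y := by
  have hflip : ContDiffAt ℝ n (fun z ↦ (fderiv ℝ g z).flip) y :=
    (ContinuousLinearMap.flipₗᵢ ℝ E E (E →L[ℝ] ℝ)).contDiff.contDiffAt.comp y
      (hk.fderiv_right hnk)
  have hinv : ContDiffAt ℝ n
      (fun z ↦ ContinuousLinearMap.compL ℝ E (E →L[ℝ] ℝ) E (g z).inverse) y :=
    (ContinuousLinearMap.compL ℝ E (E →L[ℝ] ℝ) E).contDiff.contDiffAt.comp y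
      (hg.contDiffAt_inverse (hk.of_le (le_self_add.trans hnk)))
  exact (hinv.clm_comp
    (((hk.fderiv_right hnk).add hflip).sub (contDiffAt_const.clm_comp hflip))).const_smul _

theorem differentiableAt_christoffelBilin (hg : IsMetricNear g y) :
    DifferentiableAt ℝ (christoffelBilin g) y :=
  (hg.contDiffAt_christoffelBilin (n := 1) hg.contDiffAt (by norm_num)).differentiableAt one_ne_zero

end IsMetricNear

section Connection

variable [FiniteDimensional ℝ F]

theorem differentiableAt_covDerivAlong {V : E → F} (hG : IsMetricNear G (f y))
    (hf : ContDiffAt ℝ 2 f y) (hV : ContDiffAt ℝ 2 V y) (u : E) :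
    DifferentiableAt ℝ (fun z ↦ covDerivAlong G f V z u) y := by
  have hΓ : DifferentiableAt ℝ (fun z ↦ christoffelBilin G (f z)) y :=
    hG.differentiableAt_christoffelBilin.comp y (hf.differentiableAt two_ne_zero)
  have hfu := (differentiableAt_fderiv hf).clm_apply (differentiableAt_const u)
  have hVu := (differentiableAt_fderiv hV).clm_apply (differentiableAt_const u)
  simp only [covDerivAlong, ← christoffelBilin_apply]
  exact hVu.add ((hΓ.clm_apply hfu).clm_apply (hV.differentiableAt two_ne_zero))

theorem covDerivAlong_fderiv_comm (hG : IsMetricNear G (f y)) (hf : ContDiffAt ℝ 2 f y) (u v : E) :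
    covDerivAlong G f (fun z ↦ fderiv ℝ f z v) y u
      = covDerivAlong G f (fun z ↦ fderiv ℝ f z u) y v := by
  rw [covDerivAlong, covDerivAlong, fderiv_fderiv_apply hf, fderiv_fderiv_apply hf,
    fderiv_fderiv_comm hf, hG.christoffel_comm]

theorem fderiv_metric_along {V W : E → F} (hG : IsMetricNear G (f y))
    (hf : DifferentiableAt ℝ f y) (hV : DifferentiableAt ℝ V y) (hW : DifferentiableAt ℝ W y)
    (u : E) :
    fderiv ℝ (fun z ↦ G (f z) (V z) (W z)) y u
      = G (f y) (covDerivAlong G f V y u) (W y) + G (f y) (V y) (covDerivAlong G f W y u) := by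
  have hGf : DifferentiableAt ℝ (fun z ↦ G (f z)) y := hG.differentiableAt.comp y hf
  have hDGf : fderiv ℝ (fun z ↦ G (f z)) y u = fderiv ℝ G (f y) (fderiv ℝ f y u) :=
    DFunLike.congr_fun (fderiv_comp y hG.differentiableAt hf) u
  rw [fderiv_apply_apply hGf hV hW, hDGf, hG.fderiv_apply]
  simp only [covDerivAlong, map_add, _root_.add_apply]
  ring

theorem fderiv_fderiv_metric_along {V W : E → F} (hG : IsMetricNear G (f y))
    (hf : ContDiffAt ℝ 2 f y) (hV : ContDiffAt ℝ 2 V y) (hW : ContDiffAt ℝ 2 W y) (u v : E) :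
    fderiv ℝ (fun z ↦ fderiv ℝ (fun z ↦ G (f z) (V z) (W z)) z v) y u
      = G (f y) (covDerivAlong G f (fun z ↦ covDerivAlong G f V z v) y u) (W y)
        + G (f y) (covDerivAlong G f V y v) (covDerivAlong G f W y u)
        + G (f y) (covDerivAlong G f V y u) (covDerivAlong G f W y v)
        + G (f y) (V y) (covDerivAlong G f (fun z ↦ covDerivAlong G f W z v) y u) := by
  have hfirst : (fun z ↦ fderiv ℝ (fun z ↦ G (f z) (V z) (W z)) z v) =ᶠ[𝓝 y] fun z ↦
      G (f z) (covDerivAlong G f V z v) (W z) + G (f z) (V z) (covDerivAlong G f W z v) := by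
    filter_upwards [hf.continuousAt.eventually hG.eventually, hf.eventually (by simp),
      hV.eventually (by simp), hW.eventually (by simp)] with z hGz hfz hVz hWz
    exact fderiv_metric_along hGz (hfz.differentiableAt two_ne_zero)
      (hVz.differentiableAt two_ne_zero) (hWz.differentiableAt two_ne_zero) v
  have hf₁ := hf.differentiableAt two_ne_zero
  have hV₁ := hV.differentiableAt two_ne_zero
  have hW₁ := hW.differentiableAt two_ne_zero
  have hV₂ := differentiableAt_covDerivAlong hG hf hV v
  have hW₂ := differentiableAt_covDerivAlong hG hf hW v
  have hGf : DifferentiableAt ℝ (fun z ↦ G (f z)) y := hG.differentiableAt.comp y hf₁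
  rw [hfirst.fderiv_eq, fderiv_fun_add ((hGf.clm_apply hV₂).clm_apply hW₁)
    ((hGf.clm_apply hV₁).clm_apply hW₂), _root_.add_apply, fderiv_metric_along hG hf₁ hV₂ hW₁,
    fderiv_metric_along hG hf₁ hV₁ hW₂]
  ring

theorem hessian_metric_along {V : E → F} (hG : IsMetricNear G (f y)) (hf : ContDiffAt ℝ 2 f y)
    (hV : ContDiffAt ℝ 2 V y) (u : E) :
    hessian g (fun z ↦ G (f z) (V z) (V z)) y u u
      = 2 * G (f y) (covDerivAlong₂ g G f V y u u) (V y)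
        + 2 * G (f y) (covDerivAlong G f V y u) (covDerivAlong G f V y u) := by
  have hV₁ := hV.differentiableAt two_ne_zero
  rw [hessian, fderiv_fderiv_metric_along hG hf hV hV,
    fderiv_metric_along hG (hf.differentiableAt two_ne_zero) hV₁ hV₁, covDerivAlong₂,
    hG.symm (V y), hG.symm (V y)]
  simp only [map_sub, _root_.sub_apply]
  ring

theorem hessian_congr {r s : E → ℝ} (h : r =ᶠ[𝓝 y] s) (u v : E) :
    hessian g r y u v = hessian g s y u v := by
  have hv : (fun z ↦ fderiv ℝ r z v) =ᶠ[𝓝 y] fun z ↦ fderiv ℝ s z v :=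
    h.fderiv.fun_comp (· v)
  rw [hessian, hessian, hv.fderiv_eq, h.fderiv_eq]

end Connection

section Curvature

theorem covDerivAlong_id (V : E → E) (u : E) :
    covDerivAlong g id V y u = fderiv ℝ V y u + christoffel g y u (V y) := by
  simp [covDerivAlong]

theorem curvature_antisymm (u v w : E) : curvature g y u v w = -curvature g y v u w := by
  simp only [curvature]
  abel

variable [FiniteDimensional ℝ E]

theorem isLinearMap_curvature (hg : IsMetricNear g y) (v w : E) :
    IsLinearMap ℝ fun u ↦ curvature g y u v w := by
  have hΓ := hg.differentiableAt_christoffelBilin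
  have hcurv (u : E) : curvature g y u v w
      = fderiv ℝ (christoffelBilin g) y u v w - fderiv ℝ (christoffelBilin g) y v u w
        + christoffelBilin g y u (christoffelBilin g y v w)
        - christoffelBilin g y v (christoffelBilin g y u w) := by
    have hderiv (a b c : E) : fderiv ℝ (fun z ↦ christoffelBilin g z b c) y a
        = fderiv ℝ (christoffelBilin g) y a b c := by
      rw [fderiv_apply_const (hΓ.clm_apply (differentiableAt_const b)), fderiv_apply_const hΓ]
    simp only [curvature, ← christoffelBilin_apply, hderiv]
  constructor
  · intro u u'
    simp only [hcurv, map_add, _root_.add_apply]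
    abel
  · intro c u
    simp only [hcurv, map_smul, _root_.smul_apply, smul_sub, smul_add]

theorem metric_curvature_skew (hg : IsMetricNear g y) (u v w z : E) :
    g y (curvature g y u v w) z = -g y w (curvature g y u v z) := by
  have hsmooth : ContDiffAt ℝ 2 (fun x ↦ g x w z) y :=
    (hg.contDiffAt.clm_apply contDiffAt_const).clm_apply contDiffAt_const
  have hswap := fderiv_fderiv_comm hsmooth u v
  have hsecond := fderiv_fderiv_metric_along (f := id) hg contDiffAt_id
    (contDiffAt_const (c := w)) (contDiffAt_const (c := z))
  simp only [id_eq] at hsecond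
  rw [← fderiv_fderiv_apply hsmooth, ← fderiv_fderiv_apply hsmooth, hsecond, hsecond] at hswap
  simp only [covDerivAlong_id, fderiv_const_apply, _root_.zero_apply, zero_add, map_add,
    _root_.add_apply] at hswap
  simp only [curvature, map_add, map_sub, _root_.add_apply, _root_.sub_apply]
  linarith

theorem metric_curvature_swap (hg : IsMetricNear g y) (a b : E) :
    g y (curvature g y a b b) a = g y (curvature g y b a a) b := by
  rw [metric_curvature_skew hg, curvature_antisymm, map_neg, neg_neg, hg.symm]

end Curvature

section SecondForm

/-- The second fundamental form of a `C²` map as a bilinear map. -/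
noncomputable def secondFormBilin (g : E → E →L[ℝ] E →L[ℝ] ℝ) (G : F → F →L[ℝ] F →L[ℝ] ℝ)
    (f : E → F) (y : E) : E →L[ℝ] E →L[ℝ] F :=
  fderiv ℝ (fderiv ℝ f) y
    + (christoffelBilin G (f y)).bilinearComp (fderiv ℝ f y) (fderiv ℝ f y)
    - ContinuousLinearMap.compL ℝ E E F (fderiv ℝ f y) ∘L christoffelBilin g y

theorem secondForm_eq (hf : ContDiffAt ℝ 2 f y) (u v : E) :
    secondForm g G f y u v = fderiv ℝ (fderiv ℝ f) y u v
      + christoffel G (f y) (fderiv ℝ f y u) (fderiv ℝ f y v)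
      - fderiv ℝ f y (christoffel g y u v) := by
  rw [secondForm, covDerivAlong, fderiv_fderiv_apply hf]

theorem secondFormBilin_apply (hf : ContDiffAt ℝ 2 f y) (u v : E) :
    secondFormBilin g G f y u v = secondForm g G f y u v := by
  rw [secondForm_eq hf, ← christoffelBilin_apply, ← christoffelBilin_apply]
  rfl

theorem secondForm_comp {H : X → X →L[ℝ] X →L[ℝ] ℝ} {s : F → X} (hs : ContDiffAt ℝ 2 s (f y))
    (hf : ContDiffAt ℝ 2 f y) (u v : E) :
    secondForm g H (s ∘ f) y u v = fderiv ℝ s (f y) (secondForm g G f y u v)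
      + secondForm G H s (f y) (fderiv ℝ f y u) (fderiv ℝ f y v) := by
  rw [secondForm_eq (hs.comp y hf), secondForm_eq hf, secondForm_eq hs, fderiv_fderiv_comp hs hf,
    fderiv_comp y (hs.differentiableAt two_ne_zero) (hf.differentiableAt two_ne_zero)]
  simp only [Function.comp_apply, ContinuousLinearMap.comp_apply, map_add, map_sub]
  abel

theorem secondForm_congr (h : f =ᶠ[𝓝 y] f₀) (hf : ContDiffAt ℝ 2 f y) (u v : E) :
    secondForm g G f y u v = secondForm g G f₀ y u v := by
  rw [secondForm_eq hf, secondForm_eq (hf.congr_of_eventuallyEq h.symm), h.fderiv.fderiv_eq,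
    h.fderiv_eq, h.self_of_nhds]

variable [FiniteDimensional ℝ F]

theorem metric_covDerivAlong_fderiv {V : E → F} (hG : IsMetricNear G (f y))
    (hf : ContDiffAt ℝ 2 f y) (hV : DifferentiableAt ℝ V y)
    (hnormal : ∀ᶠ z in 𝓝 y, ∀ w, G (f z) (V z) (fderiv ℝ f z w) = 0) (u w : E) :
    G (f y) (covDerivAlong G f V y u) (fderiv ℝ f y w)
      = -G (f y) (V y) (secondForm g G f y u w) := by
  have hzero : (fun z ↦ G (f z) (V z) (fderiv ℝ f z w)) =ᶠ[𝓝 y] fun _ ↦ 0 :=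
    hnormal.mono fun z hz ↦ hz w
  have hderiv := fderiv_metric_along hG (hf.differentiableAt two_ne_zero) hV
    ((differentiableAt_fderiv hf).clm_apply (differentiableAt_const w)) u
  rw [hzero.fderiv_eq, fderiv_const_apply, _root_.zero_apply] at hderiv
  rw [secondForm, map_sub, hnormal.self_of_nhds]
  linarith

variable [FiniteDimensional ℝ E]

/-- The Koszul formula expresses both terms of the second fundamental form through the derivative
of `g`. -/
theorem metric_secondForm_fderiv (hg : IsMetricNear g y) (hG : IsMetricNear G (f y))
    (hf : ContDiffAt ℝ 2 f y) (hiso : IsIsometricNear g G f y) (u v w : E) :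
    G (f y) (secondForm g G f y u v) (fderiv ℝ f y w) = 0 := by
  set S : E → E → F := fun u v ↦ covDerivAlong G f (fun z ↦ fderiv ℝ f z v) y u
  have hSsymm (u v : E) : S u v = S v u := covDerivAlong_fderiv_comm hG hf u v
  have hdiff (v : E) : DifferentiableAt ℝ (fun z ↦ fderiv ℝ f z v) y :=
    (differentiableAt_fderiv hf).clm_apply (differentiableAt_const v)
  have hcompat (u v w : E) : fderiv ℝ g y u v w
      = G (f y) (S u v) (fderiv ℝ f y w) + G (f y) (S u w) (fderiv ℝ f y v) := by
    have hpull : (fun z ↦ g z v w) =ᶠ[𝓝 y] fun z ↦ G (f z) (fderiv ℝ f z v) (fderiv ℝ f z w) :=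
      hiso.mono fun z hz ↦ (hz v w).symm
    rw [hG.symm (S u w), ← fderiv_metric_along hG (hf.differentiableAt two_ne_zero) (hdiff v)
      (hdiff w), ← hpull.fderiv_eq, fderiv_apply_const
      (hg.differentiableAt.clm_apply (differentiableAt_const v)),
      fderiv_apply_const hg.differentiableAt]
  rw [secondForm, map_sub, _root_.sub_apply, hiso.self_of_nhds, hg.apply_christoffel, hcompat u,
    hcompat v, hcompat w, hSsymm v u, hSsymm w u, hSsymm w v]
  ring

theorem secondForm_eq_zero_of_surjective (hg : IsMetricNear g y) (hG : IsMetricNear G (f y))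
    (hf : ContDiffAt ℝ 2 f y) (hiso : IsIsometricNear g G f y)
    (hsurj : Function.Surjective (fderiv ℝ f y)) (u v : E) : secondForm g G f y u v = 0 :=
  hG.eq_of_forall_apply_eq fun w ↦ by
    obtain ⟨w, rfl⟩ := hsurj w
    simp [metric_secondForm_fderiv hg hG hf hiso]

theorem contDiffAt_secondFormBilin {n k l : WithTop ℕ∞} (hg : IsMetricNear g y)
    (hG : IsMetricNear G (f y)) (hgk : ContDiffAt ℝ k g y) (hGk : ContDiffAt ℝ k G (f y))
    (hf : ContDiffAt ℝ l f y) (hnk : n + 1 ≤ k) (hkl : k + 1 ≤ l) :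
    ContDiffAt ℝ n (secondFormBilin g G f) y := by
  have hDf : ContDiffAt ℝ k (fderiv ℝ f) y := hf.fderiv_right hkl
  have hnk' : n ≤ k := le_self_add.trans hnk
  have hΓg := hg.contDiffAt_christoffelBilin hgk hnk
  have hΓG : ContDiffAt ℝ n (fun z ↦ christoffelBilin G (f z)) y :=
    (hG.contDiffAt_christoffelBilin hGk hnk).comp y
      (hf.of_le (hnk'.trans (le_self_add.trans hkl)))
  refine contDiffAt_clm_of_forall_apply fun u ↦ contDiffAt_clm_of_forall_apply fun v ↦ ?_
  have hDfn (w : E) : ContDiffAt ℝ n (fun z ↦ fderiv ℝ f z w) y :=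
    (hDf.of_le hnk').clm_apply contDiffAt_const
  exact ((((hDf.fderiv_right hnk).clm_apply contDiffAt_const).clm_apply contDiffAt_const).add
    ((hΓG.clm_apply (hDfn u)).clm_apply (hDfn v))).sub
    ((hDf.of_le hnk').clm_apply ((hΓg.clm_apply contDiffAt_const).clm_apply contDiffAt_const))

end SecondForm

section MeanCurvature

variable [FiniteDimensional ℝ E]

/-- The trace of the bilinear map `B` with respect to the nondegenerate bilinear form `β`: the sum
of the `B (b_j^♯) b_j` over any basis `b`, where `b_j^♯` is the vector representing the `j`-th
coordinate form. No frame adapted to `β` is involved, so the trace depends smoothly on `β`. -/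
noncomputable def metricTrace (β : E →L[ℝ] E →L[ℝ] ℝ) (B : E →L[ℝ] E →L[ℝ] F) : F :=
  ∑ j, B (β.inverse ((finBasis ℝ E).coord j).toContinuousLinearMap) (finBasis ℝ E j)

theorem metricTrace_eq_sum {ι : Type*} [Fintype ι] {e : ι → E} (hg : IsMetricNear g y)
    (he : ∀ x, ∑ i, g y (e i) x • e i = x) (B : E →L[ℝ] E →L[ℝ] F) :
    metricTrace (g y) B = ∑ i, B (e i) (e i) := by
  have hinv (ℓ : E →L[ℝ] ℝ) : (g y).inverse ℓ = ∑ i, ℓ (e i) • e i := by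
    rw [← he ((g y).inverse ℓ)]
    exact Finset.sum_congr rfl fun i _ ↦ by rw [hg.symm, hg.apply_inverse]
  simp only [metricTrace, hinv, map_sum, map_smul, _root_.sum_apply, _root_.smul_apply]
  rw [Finset.sum_comm]
  refine Finset.sum_congr rfl fun i _ ↦ ?_
  conv_rhs => rw [← (finBasis ℝ E).sum_repr (e i), map_sum]
  simp

/-- The mean curvature vector of `f` at `y`. -/
noncomputable def meanCurvature (g : E → E →L[ℝ] E →L[ℝ] ℝ) (G : F → F →L[ℝ] F →L[ℝ] ℝ)
    (f : E → F) (y : E) : F :=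
  (finrank ℝ E : ℝ)⁻¹ • metricTrace (g y) (secondFormBilin g G f y)

theorem contDiffAt_meanCurvature [FiniteDimensional ℝ F] {n k l : WithTop ℕ∞}
    (hg : IsMetricNear g y) (hG : IsMetricNear G (f y)) (hgk : ContDiffAt ℝ k g y)
    (hGk : ContDiffAt ℝ k G (f y)) (hf : ContDiffAt ℝ l f y) (hnk : n + 1 ≤ k)
    (hkl : k + 1 ≤ l) : ContDiffAt ℝ n (meanCurvature g G f) y := by
  have hinv := hg.contDiffAt_inverse (hgk.of_le (le_self_add.trans hnk))
  exact contDiffAt_const.smul (ContDiffAt.sum fun j _ ↦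
    ((contDiffAt_secondFormBilin hg hG hgk hGk hf hnk hkl).clm_apply
      (hinv.clm_apply contDiffAt_const)).clm_apply contDiffAt_const)

end MeanCurvature

end RiemLocal

namespace Riem

set_option maxSynthPendingDepth 3

open Filter Topology Module RiemLocal

variable {E : Type*} [NormedAddCommGroup E] [NormedSpace ℝ E]
  {H : Type*} [TopologicalSpace H] {I : ModelWithCorners ℝ E H}
  {M : Type*} [TopologicalSpace M] [ChartedSpace H M]
  {F : Type*} [NormedAddCommGroup F] [NormedSpace ℝ F]
  {H' : Type*} [TopologicalSpace H'] {J : ModelWithCorners ℝ F H'}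
  {N : Type*} [TopologicalSpace N] [ChartedSpace H' N]
  {φ : M → N} {a p x : M} {b : N}

section Chart

variable (I) in
/-- The derivative at `p` of the chart at `x`, through which tangent vectors at `p` are read in this
chart. -/
noncomputable def chartDeriv (x p : M) : TangentSpace I p →L[ℝ] E :=
  mfderiv I 𝓘(ℝ, E) (extChartAt I x) p

theorem eventually_nhds_extChartAt [I.Boundaryless] (hp : p ∈ (extChartAt I a).source)
    {P : E → Prop} (h : ∀ᶠ q in 𝓝 p, P (extChartAt I a q)) : ∀ᶠ z in 𝓝 (extChartAt I a p), P z := by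
  have hmap := map_extChartAt_nhds' hp
  rw [I.range_eq_univ, nhdsWithin_univ] at hmap
  exact hmap ▸ h

variable [IsManifold I ∞ M]

theorem chartDeriv_self (x : M) (u : TangentSpace I x) : chartDeriv I x x u = u := by
  have : IsManifold I 1 M := IsManifold.of_le (n := ∞) (by simp)
  rw [chartDeriv, mfderiv_extChartAt_self]
  rfl

theorem chartDeriv_surjective (hp : p ∈ (extChartAt I a).source) :
    Function.Surjective (chartDeriv I a p) := by
  have : IsManifold I 1 M := IsManifold.of_le (n := ∞) (by simp)
  exact (isInvertible_mfderiv_extChartAt hp).bijective.surjective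

variable [I.Boundaryless]

theorem mfderiv_symm_chartDeriv {y : E} (hy : y ∈ (extChartAt I a).target)
    (u : TangentSpace I ((extChartAt I a).symm y)) :
    mfderiv 𝓘(ℝ, E) I (extChartAt I a).symm y (chartDeriv I a ((extChartAt I a).symm y) u) = u := by
  have : IsManifold I 1 M := IsManifold.of_le (n := ∞) (by simp)
  have hinverse := mfderivWithin_extChartAt_symm_comp_mfderiv_extChartAt (I := I) hy
  rw [I.range_eq_univ, mfderivWithin_univ] at hinverse
  exact DFunLike.congr_fun hinverse u

theorem contMDiffAt_mfderiv_symm {y : E} (hy : y ∈ (extChartAt I a).target) (u : E) :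
    ContMDiffAt 𝓘(ℝ, E) I.tangent ∞ (fun z ↦ (⟨(extChartAt I a).symm z,
      mfderiv 𝓘(ℝ, E) I (extChartAt I a).symm z u⟩ : TangentBundle I M)) y := by
  have hopen := isOpen_extChartAt_target (I := I) a
  have hsymm : ContMDiffOn 𝓘(ℝ, E) I ∞ (extChartAt I a).symm (extChartAt I a).target :=
    contMDiffOn_extChartAt_symm a
  have hconst : ContMDiff 𝓘(ℝ, E) (𝓘(ℝ, E).tangent) ∞
      (fun z : E ↦ (⟨z, u⟩ : TangentBundle 𝓘(ℝ, E) E)) :=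
    contMDiff_vectorSpace_iff_contDiff.2 contDiff_const
  have hderiv := ((hsymm.contMDiffOn_tangentMapWithin (m := ∞) (by simp)
    hopen.uniqueMDiffOn).comp (s := (extChartAt I a).target) hconst.contMDiffOn
      fun z hz ↦ hz).contMDiffAt (hopen.mem_nhds hy)
  refine hderiv.congr_of_eventuallyEq ?_
  filter_upwards [hopen.mem_nhds hy] with z hz
  simp only [Function.comp_def, tangentMapWithin, mfderivWithin_of_isOpen hopen hz]

variable [Bundle.RiemannianBundle (fun x : M ↦ TangentSpace I x)]

theorem metricInChart_chartDeriv (hp : p ∈ (extChartAt I a).source) (u v : TangentSpace I p) :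
    metricInChart I a (extChartAt I a p) (chartDeriv I a p u) (chartDeriv I a p v)
      = inner ℝ u v := by
  obtain ⟨y, hy, rfl⟩ : ∃ y ∈ (extChartAt I a).target, (extChartAt I a).symm y = p :=
    ⟨_, (extChartAt I a).map_source hp, (extChartAt I a).left_inv hp⟩
  rw [(extChartAt I a).right_inv hy]
  change inner ℝ (mfderiv 𝓘(ℝ, E) I (extChartAt I a).symm y _)
    (mfderiv 𝓘(ℝ, E) I (extChartAt I a).symm y _) = _
  rw [mfderiv_symm_chartDeriv hy, mfderiv_symm_chartDeriv hy]

theorem metricInChart_self (x : M) (u v : TangentSpace I x) :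
    metricInChart I x (extChartAt I x x) u v = inner ℝ u v := by
  simpa only [chartDeriv_self] using metricInChart_chartDeriv (mem_extChartAt_source (I := I) x) u v

variable [FiniteDimensional ℝ E]
  [IsContMDiffRiemannianBundle I ∞ E (fun x : M ↦ TangentSpace I x)]

theorem contDiffAt_metricInChart {y : E} (hy : y ∈ (extChartAt I a).target) :
    ContDiffAt ℝ ∞ (metricInChart I a) y := by
  refine contDiffAt_clm_of_forall_apply fun u ↦ contDiffAt_clm_of_forall_apply fun v ↦ ?_
  have hinner : ContMDiffAt 𝓘(ℝ, E) 𝓘(ℝ, ℝ) ∞ (fun z ↦ metricInChart I a z u v) y :=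
    ContMDiffAt.inner_bundle (F := E) (E := fun x : M ↦ TangentSpace I x) (IB := I)
      (b := (extChartAt I a).symm) (contMDiffAt_mfderiv_symm hy u) (contMDiffAt_mfderiv_symm hy v)
  exact hinner.contDiffAt

theorem isMetricNear_metricInChart {y : E} (hy : y ∈ (extChartAt I a).target) :
    IsMetricNear (metricInChart I a) y := by
  refine ⟨(contDiffAt_metricInChart hy).of_le (by norm_cast),
    .of_forall fun z u v ↦ real_inner_comm (mfderiv 𝓘(ℝ, E) I (extChartAt I a).symm z v) _, ?_⟩
  filter_upwards [(isOpen_extChartAt_target (I := I) a).mem_nhds hy] with z hz u hu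
  obtain ⟨q, hq, rfl⟩ : ∃ q ∈ (extChartAt I a).source, extChartAt I a q = z :=
    ⟨_, (extChartAt I a).map_target hz, (extChartAt I a).right_inv hz⟩
  obtain ⟨u, rfl⟩ := chartDeriv_surjective hq u
  rw [metricInChart_chartDeriv hq]
  exact real_inner_self_pos.2 fun h ↦ hu (by rw [h, map_zero])

end Chart

section Map

variable (I J) in
/-- The coordinate expression of `φ` in the charts at `a` and `b`. When `φ` is the identity it is a
change of coordinates, and when `b = φ a` it is `writtenInExtChartAt I J a φ`. -/
noncomputable def coordMap (φ : M → N) (a : M) (b : N) : E → F :=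
  extChartAt J b ∘ φ ∘ (extChartAt I a).symm

theorem coordMap_extChartAt (hp : p ∈ (extChartAt I a).source) :
    coordMap I J φ a b (extChartAt I a p) = extChartAt J b (φ p) := by
  simp only [coordMap, Function.comp_apply, (extChartAt I a).left_inv hp]

theorem writtenInExtChartAt_self (φ : M → N) (x : M) :
    writtenInExtChartAt I J x φ (extChartAt I x x) = extChartAt J (φ x) (φ x) :=
  coordMap_extChartAt (mem_extChartAt_source x)

theorem coordMap_comp_eventuallyEq [I.Boundaryless] {K : Type*} [NormedAddCommGroup K]
    [NormedSpace ℝ K] {H'' : Type*} [TopologicalSpace H''] {L : ModelWithCorners ℝ K H''}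
    {P : Type*} [TopologicalSpace P] [ChartedSpace H'' P] {ψ : N → P} {c : P}
    (hφ : ContinuousAt φ p) (hp : p ∈ (extChartAt I a).source)
    (hb : φ p ∈ (extChartAt J b).source) :
    coordMap J L ψ b c ∘ coordMap I J φ a b =ᶠ[𝓝 (extChartAt I a p)]
      coordMap I L (ψ ∘ φ) a c := by
  refine eventually_nhds_extChartAt hp ?_
  filter_upwards [extChartAt_source_mem_nhds' hp, hφ (extChartAt_source_mem_nhds' hb)] with q hq hqb
  rw [Function.comp_apply, coordMap_extChartAt hq, coordMap_extChartAt hqb, coordMap_extChartAt hq,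
    Function.comp_apply]

variable [IsManifold I ∞ M] [IsManifold J ∞ N] [I.Boundaryless]

theorem contDiffAt_coordMap (hφ : ContMDiffAt I J ∞ φ p) (hp : p ∈ (extChartAt I a).source)
    (hb : φ p ∈ (extChartAt J b).source) :
    ContDiffAt ℝ ∞ (coordMap I J φ a b) (extChartAt I a p) := by
  have hsymm : ContMDiffAt 𝓘(ℝ, E) I ∞ (extChartAt I a).symm (extChartAt I a p) :=
    (contMDiffOn_extChartAt_symm a).contMDiffAt
      ((isOpen_extChartAt_target a).mem_nhds ((extChartAt I a).map_source hp))
  have hchart : ContMDiffAt J 𝓘(ℝ, F) ∞ (extChartAt J b) (φ p) :=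
    contMDiffAt_extChartAt' (by rwa [extChartAt_source] at hb)
  rw [← (extChartAt I a).left_inv hp] at hφ hchart
  exact (hchart.comp (extChartAt I a p) (hφ.comp (extChartAt I a p) hsymm)).contDiffAt

theorem contDiffAt_writtenInExtChartAt (hφ : ContMDiffAt I J ∞ φ x) :
    ContDiffAt ℝ ∞ (writtenInExtChartAt I J x φ) (extChartAt I x x) :=
  contDiffAt_coordMap hφ (mem_extChartAt_source x) (mem_extChartAt_source (φ x))

theorem fderiv_coordMap_chartDeriv (hφ : ContMDiffAt I J ∞ φ p)
    (hp : p ∈ (extChartAt I a).source) (hb : φ p ∈ (extChartAt J b).source)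
    (u : TangentSpace I p) :
    fderiv ℝ (coordMap I J φ a b) (extChartAt I a p) (chartDeriv I a p u)
      = chartDeriv J b (φ p) (mfderiv I J φ p u) := by
  have hcomp : coordMap I J φ a b ∘ extChartAt I a =ᶠ[𝓝 p] extChartAt J b ∘ φ := by
    filter_upwards [extChartAt_source_mem_nhds' hp] with q hq using coordMap_extChartAt hq
  have hcoord := (contDiffAt_coordMap hφ hp hb).contMDiffAt.mdifferentiableAt (by simp)
  have ha : MDifferentiableAt I 𝓘(ℝ, E) (extChartAt I a) p :=
    (contMDiffAt_extChartAt' (n := ∞) (by rwa [extChartAt_source] at hp)).mdifferentiableAt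
      (by simp)
  have hb : MDifferentiableAt J 𝓘(ℝ, F) (extChartAt J b) (φ p) :=
    (contMDiffAt_extChartAt' (n := ∞) (by rwa [extChartAt_source] at hb)).mdifferentiableAt
      (by simp)
  have hderiv := hcomp.mfderiv_eq (I := I) (I' := 𝓘(ℝ, F))
  rw [mfderiv_comp p hcoord ha, mfderiv_comp p hb (hφ.mdifferentiableAt (by simp)),
    mfderiv_eq_fderiv] at hderiv
  exact DFunLike.congr_fun hderiv u

theorem fderiv_writtenInExtChartAt (hφ : ContMDiffAt I J ∞ φ x) (u : TangentSpace I x) :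
    fderiv ℝ (writtenInExtChartAt I J x φ) (extChartAt I x x) u = mfderiv I J φ x u := by
  have hderiv := fderiv_coordMap_chartDeriv hφ (mem_extChartAt_source (I := I) x)
    (mem_extChartAt_source (I := J) (φ x)) u
  rw [chartDeriv_self, chartDeriv_self] at hderiv
  exact hderiv

theorem fderiv_coordMap_id (hx : p ∈ (extChartAt I x).source) (ha : p ∈ (extChartAt I a).source)
    (u : TangentSpace I p) :
    fderiv ℝ (coordMap I I id x a) (extChartAt I x p) (chartDeriv I x p u)
      = chartDeriv I a p u := by
  simpa [mfderiv_id] using fderiv_coordMap_chartDeriv contMDiffAt_id hx ha u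

theorem secondForm_coordMap_comp [J.Boundaryless] {K : Type*} [NormedAddCommGroup K]
    [NormedSpace ℝ K] {H'' : Type*} [TopologicalSpace H''] {L : ModelWithCorners ℝ K H''}
    {P : Type*} [TopologicalSpace P] [ChartedSpace H'' P] [IsManifold L ∞ P] {ψ : N → P} {c : P}
    (hψ : ContMDiffAt J L ∞ ψ (φ p)) (hφ : ContMDiffAt I J ∞ φ p)
    (hp : p ∈ (extChartAt I a).source) (hb : φ p ∈ (extChartAt J b).source)
    (hc : ψ (φ p) ∈ (extChartAt L c).source) (g : E → E →L[ℝ] E →L[ℝ] ℝ)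
    (G : F → F →L[ℝ] F →L[ℝ] ℝ) (k : K → K →L[ℝ] K →L[ℝ] ℝ) (u v : E) :
    RiemLocal.secondForm g k (coordMap I L (ψ ∘ φ) a c) (extChartAt I a p) u v
      = fderiv ℝ (coordMap J L ψ b c) (extChartAt J b (φ p))
          (RiemLocal.secondForm g G (coordMap I J φ a b) (extChartAt I a p) u v)
        + RiemLocal.secondForm G k (coordMap J L ψ b c) (extChartAt J b (φ p))
          (fderiv ℝ (coordMap I J φ a b) (extChartAt I a p) u)
          (fderiv ℝ (coordMap I J φ a b) (extChartAt I a p) v) := by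
  have hφ₂ : ContDiffAt ℝ 2 (coordMap I J φ a b) (extChartAt I a p) :=
    (contDiffAt_coordMap hφ hp hb).of_le (by norm_cast)
  have hψ₂ : ContDiffAt ℝ 2 (coordMap J L ψ b c) (coordMap I J φ a b (extChartAt I a p)) := by
    rw [coordMap_extChartAt hp]
    exact (contDiffAt_coordMap hψ hb hc).of_le (by norm_cast)
  rw [← secondForm_congr (coordMap_comp_eventuallyEq hφ.continuousAt hp hb) (hψ₂.comp _ hφ₂),
    secondForm_comp hψ₂ hφ₂, coordMap_extChartAt hp]

end Map

section Immersion

variable [Bundle.RiemannianBundle (fun x : M ↦ TangentSpace I x)]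
  [Bundle.RiemannianBundle (fun p : N ↦ TangentSpace J p)]

theorem isIsometricImmersion_id : IsIsometricImmersion I I (id : M → M) where
  contMDiff := contMDiff_id
  inner_mfderiv x u v := by
    rw [mfderiv_id]
    rfl

theorem finrank_smul_meanCurvature [FiniteDimensional ℝ E] (φ : M → N) (x : M) :
    (finrank ℝ E : ℝ) • meanCurvature I J φ x = ∑ i, secondForm I J φ x
      (stdOrthonormalBasis ℝ (TangentSpace I x) i)
      (stdOrthonormalBasis ℝ (TangentSpace I x) i) := by
  rcases eq_or_ne (finrank ℝ E) 0 with hm | hm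
  · have : IsEmpty (Fin (finrank ℝ (TangentSpace I x))) :=
      ⟨fun i ↦ Nat.not_lt_zero _ (i.isLt.trans_eq hm)⟩
    rw [hm, Nat.cast_zero, zero_smul, Fintype.sum_empty]
  · exact smul_inv_smul₀ (Nat.cast_ne_zero.2 hm) _

variable [IsManifold I ∞ M] [I.Boundaryless] [IsManifold J ∞ N] [J.Boundaryless]

theorem isIsometricNear_coordMap (hφ : IsIsometricImmersion I J φ)
    (hp : p ∈ (extChartAt I a).source) (hb : φ p ∈ (extChartAt J b).source) :
    IsIsometricNear (metricInChart I a) (metricInChart J b) (coordMap I J φ a b)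
      (extChartAt I a p) := by
  refine eventually_nhds_extChartAt hp ?_
  filter_upwards [extChartAt_source_mem_nhds' hp,
    hφ.contMDiff.continuous.continuousAt (extChartAt_source_mem_nhds' hb)] with q hq hqb u v
  obtain ⟨u, rfl⟩ := chartDeriv_surjective hq u
  obtain ⟨v, rfl⟩ := chartDeriv_surjective hq v
  rw [coordMap_extChartAt hq, fderiv_coordMap_chartDeriv (hφ.contMDiff q) hq hqb,
    fderiv_coordMap_chartDeriv (hφ.contMDiff q) hq hqb, metricInChart_chartDeriv hqb,
    metricInChart_chartDeriv hq, hφ.inner_mfderiv]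

variable [FiniteDimensional ℝ E] [FiniteDimensional ℝ F]
  [IsContMDiffRiemannianBundle I ∞ E (fun x : M ↦ TangentSpace I x)]

theorem secondForm_coordMap_id (hx : p ∈ (extChartAt I x).source)
    (ha : p ∈ (extChartAt I a).source) (u v : E) :
    RiemLocal.secondForm (metricInChart I x) (metricInChart I a) (coordMap I I id x a)
      (extChartAt I x p) u v = 0 := by
  have hsurj : Function.Surjective (fderiv ℝ (coordMap I I id x a) (extChartAt I x p)) := by
    intro w
    obtain ⟨w, rfl⟩ := chartDeriv_surjective ha w
    exact ⟨chartDeriv I x p w, fderiv_coordMap_id hx ha w⟩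
  refine secondForm_eq_zero_of_surjective
    (isMetricNear_metricInChart ((extChartAt I x).map_source hx)) ?_
    ((contDiffAt_coordMap contMDiffAt_id hx ha).of_le (by norm_cast))
    (isIsometricNear_coordMap isIsometricImmersion_id hx ha) hsurj u v
  rw [coordMap_extChartAt hx]
  exact isMetricNear_metricInChart ((extChartAt I a).map_source ha)

variable [IsContMDiffRiemannianBundle J ∞ F (fun x : N ↦ TangentSpace J x)]

theorem chartDeriv_secondForm (hφ : ContMDiff I J ∞ φ) (hp : p ∈ (extChartAt I a).source)
    (hb : φ p ∈ (extChartAt J b).source) (u v : TangentSpace I p) :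
    chartDeriv J b (φ p) (secondForm I J φ p u v)
      = RiemLocal.secondForm (metricInChart I a) (metricInChart J b) (coordMap I J φ a b)
          (extChartAt I a p) (chartDeriv I a p u) (chartDeriv I a p v) := by
  have hp₀ := mem_extChartAt_source (I := I) p
  have hφp₀ := mem_extChartAt_source (I := J) (φ p)
  have hsource := secondForm_coordMap_comp (hφ p) contMDiffAt_id hp₀ hp hb (metricInChart I p)
    (metricInChart I a) (metricInChart J b) (chartDeriv I p p u) (chartDeriv I p p v)
  have htarget := secondForm_coordMap_comp contMDiffAt_id (hφ p) hp₀ hφp₀ hb (metricInChart I p)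
    (metricInChart J (φ p)) (metricInChart J b) u v
  rw [secondForm_coordMap_id hp₀ hp, map_zero, zero_add, fderiv_coordMap_id hp₀ hp,
    fderiv_coordMap_id hp₀ hp, chartDeriv_self, chartDeriv_self] at hsource
  rw [secondForm_coordMap_id hφp₀ hb, add_zero] at htarget
  calc chartDeriv J b (φ p) (secondForm I J φ p u v)
      = fderiv ℝ (coordMap J J id (φ p) b) (extChartAt J (φ p) (φ p))
          (chartDeriv J (φ p) (φ p) (secondForm I J φ p u v)) :=
        (fderiv_coordMap_id hφp₀ hb _).symm
    _ = RiemLocal.secondForm (metricInChart I p) (metricInChart J b) (coordMap I J φ p b)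
          (extChartAt I p p) u v := by
        rw [chartDeriv_self]
        exact htarget.symm
    _ = _ := hsource

theorem chartDeriv_meanCurvature (hφ : ContMDiff I J ∞ φ) (hp : p ∈ (extChartAt I a).source)
    (hb : φ p ∈ (extChartAt J b).source) :
    chartDeriv J b (φ p) (meanCurvature I J φ p)
      = RiemLocal.meanCurvature (metricInChart I a) (metricInChart J b) (coordMap I J φ a b)
          (extChartAt I a p) := by
  have hframe (w : E) : ∑ i, metricInChart I a (extChartAt I a p)
      (chartDeriv I a p (stdOrthonormalBasis ℝ (TangentSpace I p) i)) w
        • chartDeriv I a p (stdOrthonormalBasis ℝ (TangentSpace I p) i) = w := by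
    obtain ⟨w, rfl⟩ := chartDeriv_surjective hp w
    simp only [metricInChart_chartDeriv hp, ← map_smul, ← map_sum, OrthonormalBasis.sum_repr']
  rw [RiemLocal.meanCurvature, metricTrace_eq_sum
    (isMetricNear_metricInChart ((extChartAt I a).map_source hp)) hframe, meanCurvature, map_smul,
    map_sum]
  simp only [chartDeriv_secondForm hφ hp hb, secondFormBilin_apply
    ((contDiffAt_coordMap (hφ p) hp hb).of_le (by norm_cast))]

end Immersion

section VectorFieldAlong

variable {V : (x : M) → TangentSpace J (φ x)}

theorem sectionInCharts_extChartAt (hp : p ∈ (extChartAt I x).source) :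
    sectionInCharts I J φ V x (extChartAt I x p) = chartDeriv J (φ x) (φ p) (V p) :=
  congrArg (fun q ↦ chartDeriv J (φ x) (φ q) (V q)) ((extChartAt I x).left_inv hp)

variable [IsManifold J ∞ N]

theorem sectionInCharts_self (V : (x : M) → TangentSpace J (φ x)) (x : M) :
    sectionInCharts I J φ V x (extChartAt I x x) = V x := by
  rw [sectionInCharts_extChartAt (mem_extChartAt_source x), chartDeriv_self]

variable [Bundle.RiemannianBundle (fun p : N ↦ TangentSpace J p)]

variable (I J) in
/-- The covariant derivative `∇^φ_u V` at `x` of a vector field `V` along `φ`. -/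
noncomputable def covDerivAlong (φ : M → N) (V : (x : M) → TangentSpace J (φ x)) (x : M)
    (u : TangentSpace I x) : TangentSpace J (φ x) :=
  RiemLocal.covDerivAlong (E := E) (F := F) (metricInChart J (φ x)) (writtenInExtChartAt I J x φ)
    (sectionInCharts I J φ V x) (extChartAt I x x) u

variable (I J) in
/-- The second covariant derivative `∇^φ_u ∇^φ_v V - ∇^φ_{∇_u v} V` at `x` of a vector field `V`
along `φ`; `Δ^φ V` is its trace. -/
noncomputable def covDerivAlong₂ [Bundle.RiemannianBundle (fun x : M ↦ TangentSpace I x)]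
    (φ : M → N) (V : (x : M) → TangentSpace J (φ x)) (x : M) (u v : TangentSpace I x) :
    TangentSpace J (φ x) :=
  RiemLocal.covDerivAlong₂ (E := E) (F := F) (metricInChart I x) (metricInChart J (φ x))
    (writtenInExtChartAt I J x φ) (sectionInCharts I J φ V x) (extChartAt I x x) u v

variable [J.Boundaryless]

theorem metricInChart_writtenInExtChartAt (x : M) (u v : TangentSpace J (φ x)) :
    metricInChart J (φ x) (writtenInExtChartAt I J x φ (extChartAt I x x)) u v = inner ℝ u v := by
  rw [writtenInExtChartAt_self]
  exact metricInChart_self _ u v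

theorem isMetricNear_writtenInExtChartAt [FiniteDimensional ℝ F]
    [IsContMDiffRiemannianBundle J ∞ F (fun x : N ↦ TangentSpace J x)] (φ : M → N) (x : M) :
    IsMetricNear (metricInChart J (φ x)) (writtenInExtChartAt I J x φ (extChartAt I x x)) := by
  rw [writtenInExtChartAt_self]
  exact isMetricNear_metricInChart (mem_extChartAt_target (φ x))

variable [I.Boundaryless]

theorem norm_sq_comp_symm_eventuallyEq (hφ : ContinuousAt φ x)
    (V : (x : M) → TangentSpace J (φ x)) :
    (fun p ↦ ‖V p‖ ^ 2) ∘ (extChartAt I x).symm =ᶠ[𝓝 (extChartAt I x x)] fun z ↦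
      metricInChart J (φ x) (writtenInExtChartAt I J x φ z) (sectionInCharts I J φ V x z)
        (sectionInCharts I J φ V x z) := by
  refine eventually_nhds_extChartAt (mem_extChartAt_source x) ?_
  filter_upwards [extChartAt_source_mem_nhds (I := I) x,
    hφ (extChartAt_source_mem_nhds (I := J) (φ x))] with p hp hφp
  have hcoord : writtenInExtChartAt I J x φ (extChartAt I x p) = extChartAt J (φ x) (φ p) :=
    coordMap_extChartAt hp
  rw [sectionInCharts_extChartAt hp, hcoord, metricInChart_chartDeriv hφp,
    real_inner_self_eq_norm_sq, Function.comp_apply, (extChartAt I x).left_inv hp]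

variable [IsManifold I ∞ M] [FiniteDimensional ℝ F]
  [IsContMDiffRiemannianBundle J ∞ F (fun x : N ↦ TangentSpace J x)]

theorem contMDiffAt_norm_sq (hφ : ContMDiffAt I J ∞ φ x)
    (hV : ContDiffAt ℝ ∞ (sectionInCharts I J φ V x) (extChartAt I x x)) :
    ContMDiffAt I 𝓘(ℝ, ℝ) ∞ (fun p ↦ ‖V p‖ ^ 2) x := by
  have hmetric : ContDiffAt ℝ ∞ (metricInChart J (φ x))
      (writtenInExtChartAt I J x φ (extChartAt I x x)) := by
    rw [writtenInExtChartAt_self]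
    exact contDiffAt_metricInChart (mem_extChartAt_target (φ x))
  have hchart := (((hmetric.comp _ (contDiffAt_writtenInExtChartAt hφ)).clm_apply hV).clm_apply
    hV).congr_of_eventuallyEq (norm_sq_comp_symm_eventuallyEq hφ.continuousAt V)
  refine (hchart.contMDiffAt.comp x contMDiffAt_extChartAt).congr_of_eventuallyEq ?_
  filter_upwards [extChartAt_source_mem_nhds (I := I) x] with p hp
  exact congrArg (fun p ↦ ‖V p‖ ^ 2) ((extChartAt I x).left_inv hp).symm

variable [FiniteDimensional ℝ E] [Bundle.RiemannianBundle (fun x : M ↦ TangentSpace I x)]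

theorem laplacian_norm_sq (hφ : ContMDiffAt I J ∞ φ x)
    (hV : ContDiffAt ℝ 2 (sectionInCharts I J φ V x) (extChartAt I x x)) :
    laplacian I (fun p ↦ ‖V p‖ ^ 2) x = 2 * inner ℝ (roughLaplacian I J φ V x) (V x)
      + 2 * ∑ i, ‖covDerivAlong I J φ V x (stdOrthonormalBasis ℝ (TangentSpace I x) i)‖ ^ 2 := by
  have hφ₂ : ContDiffAt ℝ 2 (writtenInExtChartAt I J x φ) (extChartAt I x x) :=
    (contDiffAt_writtenInExtChartAt hφ).of_le (by norm_cast)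
  have hhessian (u : TangentSpace I x) : hessian (metricInChart I x)
      ((fun p ↦ ‖V p‖ ^ 2) ∘ (extChartAt I x).symm) (extChartAt I x x) u u
        = 2 * inner ℝ (covDerivAlong₂ I J φ V x u u) (V x)
          + 2 * ‖covDerivAlong I J φ V x u‖ ^ 2 := by
    refine (hessian_congr (norm_sq_comp_symm_eventuallyEq hφ.continuousAt V) _ _).trans
      ((hessian_metric_along (isMetricNear_writtenInExtChartAt φ x) hφ₂ hV u).trans ?_)
    rw [sectionInCharts_self, ← real_inner_self_eq_norm_sq,
      ← metricInChart_writtenInExtChartAt (I := I) x,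
      ← metricInChart_writtenInExtChartAt (I := I) x]
    rfl
  have htrace : roughLaplacian I J φ V x = ∑ i, covDerivAlong₂ I J φ V x
      (stdOrthonormalBasis ℝ (TangentSpace I x) i)
      (stdOrthonormalBasis ℝ (TangentSpace I x) i) := rfl
  rw [htrace, sum_inner, Finset.mul_sum, Finset.mul_sum, ← Finset.sum_add_distrib]
  exact Finset.sum_congr rfl fun i _ ↦ hhessian _

end VectorFieldAlong

section MeanCurvature

variable {V : (x : M) → TangentSpace J (φ x)}
  [IsManifold I ∞ M] [I.Boundaryless] [Bundle.RiemannianBundle (fun x : M ↦ TangentSpace I x)]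
  [FiniteDimensional ℝ F] [IsManifold J ∞ N] [J.Boundaryless]
  [Bundle.RiemannianBundle (fun p : N ↦ TangentSpace J p)]
  [IsContMDiffRiemannianBundle J ∞ F (fun x : N ↦ TangentSpace J x)]

theorem inner_covDerivAlong_mfderiv (hφ : ContMDiff I J ∞ φ)
    (hV : DifferentiableAt ℝ (sectionInCharts I J φ V x) (extChartAt I x x))
    (hnormal : ∀ᶠ p in 𝓝 x, ∀ w, inner ℝ (V p) (mfderiv I J φ p w) = 0) (u w : TangentSpace I x) :
    inner ℝ (covDerivAlong I J φ V x u) (mfderiv I J φ x w)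
      = -inner ℝ (V x) (secondForm I J φ x u w) := by
  have hchart : ∀ᶠ z in 𝓝 (extChartAt I x x), ∀ w,
      metricInChart J (φ x) (writtenInExtChartAt I J x φ z) (sectionInCharts I J φ V x z)
        (fderiv ℝ (writtenInExtChartAt I J x φ) z w) = 0 := by
    refine eventually_nhds_extChartAt (mem_extChartAt_source x) ?_
    filter_upwards [hnormal, extChartAt_source_mem_nhds (I := I) x,
      hφ.continuous.continuousAt (extChartAt_source_mem_nhds (I := J) (φ x))] with p hp hpx hφp w
    obtain ⟨w, rfl⟩ := chartDeriv_surjective hpx w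
    have hderiv : fderiv ℝ (writtenInExtChartAt I J x φ) (extChartAt I x p) (chartDeriv I x p w)
        = chartDeriv J (φ x) (φ p) (mfderiv I J φ p w) :=
      fderiv_coordMap_chartDeriv (hφ p) hpx hφp w
    have hcoord : writtenInExtChartAt I J x φ (extChartAt I x p) = extChartAt J (φ x) (φ p) :=
      coordMap_extChartAt hpx
    rw [hderiv, hcoord, sectionInCharts_extChartAt hpx, metricInChart_chartDeriv hφp, hp]
  have hweingarten := metric_covDerivAlong_fderiv (g := metricInChart I x)
    (isMetricNear_writtenInExtChartAt φ x)
    ((contDiffAt_writtenInExtChartAt (hφ x)).of_le (by norm_cast)) hV hchart u w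
  rw [fderiv_writtenInExtChartAt (hφ x), sectionInCharts_self] at hweingarten
  rw [← metricInChart_writtenInExtChartAt (I := I) x,
    ← metricInChart_writtenInExtChartAt (I := I) x]
  exact hweingarten

variable [FiniteDimensional ℝ E] [IsContMDiffRiemannianBundle I ∞ E (fun x : M ↦ TangentSpace I x)]

theorem inner_secondForm_mfderiv (hφ : IsIsometricImmersion I J φ) (x : M)
    (u v w : TangentSpace I x) :
    inner ℝ (secondForm I J φ x u v) (mfderiv I J φ x w) = 0 := by
  have hnormal := metric_secondForm_fderiv
    (isMetricNear_metricInChart (mem_extChartAt_target (I := I) x))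
    (isMetricNear_writtenInExtChartAt φ x)
    ((contDiffAt_writtenInExtChartAt (hφ.contMDiff x)).of_le (by norm_cast))
    (isIsometricNear_coordMap hφ (mem_extChartAt_source x) (mem_extChartAt_source (φ x))) u v w
  rw [fderiv_writtenInExtChartAt (hφ.contMDiff x)] at hnormal
  rw [← metricInChart_writtenInExtChartAt (I := I) x]
  exact hnormal

theorem inner_meanCurvature_mfderiv (hφ : IsIsometricImmersion I J φ) (x : M)
    (w : TangentSpace I x) :
    inner ℝ (meanCurvature I J φ x) (mfderiv I J φ x w) = 0 := by
  simp only [meanCurvature, real_inner_smul_left, sum_inner, inner_secondForm_mfderiv hφ,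
    Finset.sum_const_zero, mul_zero]

theorem contDiffAt_sectionInCharts_meanCurvature (hφ : ContMDiff I J ∞ φ) (x : M) :
    ContDiffAt ℝ ∞ (sectionInCharts I J φ (meanCurvature I J φ) x) (extChartAt I x x) := by
  have hlocal : sectionInCharts I J φ (meanCurvature I J φ) x =ᶠ[𝓝 (extChartAt I x x)]
      RiemLocal.meanCurvature (metricInChart I x) (metricInChart J (φ x))
        (writtenInExtChartAt I J x φ) := by
    refine eventually_nhds_extChartAt (mem_extChartAt_source x) ?_
    filter_upwards [extChartAt_source_mem_nhds (I := I) x,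
      hφ.continuous.continuousAt (extChartAt_source_mem_nhds (I := J) (φ x))] with p hp hφp
    rw [sectionInCharts_extChartAt hp]
    exact chartDeriv_meanCurvature hφ hp hφp
  refine ContDiffAt.congr_of_eventuallyEq ?_ hlocal
  refine contDiffAt_meanCurvature (k := ∞) (l := ∞)
    (isMetricNear_metricInChart (mem_extChartAt_target x))
    (isMetricNear_writtenInExtChartAt φ x) (contDiffAt_metricInChart (mem_extChartAt_target x)) ?_
    (contDiffAt_writtenInExtChartAt (hφ x)) (by simp) (by simp)
  rw [writtenInExtChartAt_self]
  exact contDiffAt_metricInChart (mem_extChartAt_target (φ x))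

theorem sum_inner_covDerivAlong_meanCurvature (hφ : IsIsometricImmersion I J φ) (x : M) :
    ∑ i, inner ℝ (covDerivAlong I J φ (meanCurvature I J φ) x
        (stdOrthonormalBasis ℝ (TangentSpace I x) i))
        (mfderiv I J φ x (stdOrthonormalBasis ℝ (TangentSpace I x) i))
      = -(finrank ℝ E * ‖meanCurvature I J φ x‖ ^ 2) := by
  have hdiff := (contDiffAt_sectionInCharts_meanCurvature hφ.contMDiff x).differentiableAt
    (by simp)
  simp only [inner_covDerivAlong_mfderiv hφ.contMDiff hdiff
    (.of_forall (inner_meanCurvature_mfderiv hφ)), Finset.sum_neg_distrib, ← inner_sum,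
    ← finrank_smul_meanCurvature, real_inner_smul_right, real_inner_self_eq_norm_sq]

theorem finrank_mul_norm_meanCurvature_pow_four_le (hφ : IsIsometricImmersion I J φ) (x : M) :
    finrank ℝ E * ‖meanCurvature I J φ x‖ ^ 4
      ≤ ∑ i, ‖covDerivAlong I J φ (meanCurvature I J φ) x
          (stdOrthonormalBasis ℝ (TangentSpace I x) i)‖ ^ 2 := by
  set e := stdOrthonormalBasis ℝ (TangentSpace I x)
  set D := covDerivAlong I J φ (meanCurvature I J φ) x
  have hcomponent (i) : inner ℝ (D (e i)) (mfderiv I J φ x (e i)) ^ 2 ≤ ‖D (e i)‖ ^ 2 := by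
    have hunit : ‖mfderiv I J φ x (e i)‖ = 1 := by
      rw [norm_eq_sqrt_real_inner, hφ.inner_mfderiv, real_inner_self_eq_norm_sq,
        e.orthonormal.1, one_pow, Real.sqrt_one]
    rw [sq_le_sq, abs_norm]
    simpa only [hunit, mul_one] using
      abs_real_inner_le_norm (D (e i)) (mfderiv I J φ x (e i))
  have hm : (finrank ℝ E : ℝ) * (finrank ℝ E * ‖meanCurvature I J φ x‖ ^ 4)
      ≤ finrank ℝ E * ∑ i, ‖D (e i)‖ ^ 2 :=
    calc (finrank ℝ E : ℝ) * (finrank ℝ E * ‖meanCurvature I J φ x‖ ^ 4)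
        = (∑ i, inner ℝ (D (e i)) (mfderiv I J φ x (e i))) ^ 2 := by
          rw [sum_inner_covDerivAlong_meanCurvature hφ]
          ring
      _ ≤ finrank ℝ (TangentSpace I x) * ∑ i, inner ℝ (D (e i)) (mfderiv I J φ x (e i)) ^ 2 := by
          simpa only [Finset.card_univ, Fintype.card_fin] using
            sq_sum_le_card_mul_sum_sq (s := Finset.univ)
              (f := fun i ↦ inner ℝ (D (e i)) (mfderiv I J φ x (e i)))
      _ ≤ finrank ℝ E * ∑ i, ‖D (e i)‖ ^ 2 :=
          mul_le_mul_of_nonneg_left (Finset.sum_le_sum fun i _ ↦ hcomponent i) (Nat.cast_nonneg _)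
  rcases (finrank ℝ E).eq_zero_or_pos with hzero | hpos
  · rw [hzero, Nat.cast_zero, zero_mul]
    positivity
  · exact le_of_mul_le_mul_left hm (Nat.cast_pos.2 hpos)

end MeanCurvature

section Curvature

variable [FiniteDimensional ℝ E] [IsManifold I ∞ M] [I.Boundaryless]
  [Bundle.RiemannianBundle (fun x : M ↦ TangentSpace I x)]
  [IsContMDiffRiemannianBundle I ∞ E (fun x : M ↦ TangentSpace I x)]

theorem inner_curvature_self_right (x : M) (u v w : TangentSpace I x) :
    inner ℝ (curvature I x u v w) w = 0 := by
  have hskew := metric_curvature_skew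
    (isMetricNear_metricInChart (mem_extChartAt_target (I := I) x)) u v w w
  have hinner := (metricInChart_self x (curvature I x u v w) w).symm.trans
    (hskew.trans (congrArg Neg.neg (metricInChart_self x w (curvature I x u v w))))
  linarith [real_inner_comm w (curvature I x u v w)]

theorem inner_curvature_swap (x : M) (u v : TangentSpace I x) :
    inner ℝ (curvature I x u v v) u = inner ℝ (curvature I x v u u) v := by
  have hswap := metric_curvature_swap
    (isMetricNear_metricInChart (mem_extChartAt_target (I := I) x)) u v
  exact (metricInChart_self x (curvature I x u v v) u).symm.trans
    (hswap.trans (metricInChart_self x (curvature I x v u u) v))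

theorem ricci_eq_sum {ι : Type*} [Fintype ι] (x : M) (u v : TangentSpace I x)
    (e : OrthonormalBasis ι ℝ (TangentSpace I x)) :
    ricci I x u v = ∑ a, inner ℝ (curvature I x (e a) u v) (e a) := by
  let T : TangentSpace I x →ₗ[ℝ] TangentSpace I x := IsLinearMap.mk' (M := E) (M₂ := E) _
    (isLinearMap_curvature (isMetricNear_metricInChart (mem_extChartAt_target (I := I) x)) u v)
  have htrace : ∑ a, inner ℝ (stdOrthonormalBasis ℝ (TangentSpace I x) a)
      (T (stdOrthonormalBasis ℝ (TangentSpace I x) a)) = ∑ a, inner ℝ (e a) (T (e a)) :=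
    (T.trace_eq_sum_inner (stdOrthonormalBasis ℝ (TangentSpace I x))).symm.trans
      (T.trace_eq_sum_inner e)
  exact (Finset.sum_congr rfl fun a _ ↦ real_inner_comm _ _).trans
    (htrace.trans (Finset.sum_congr rfl fun a _ ↦ real_inner_comm _ _))

theorem ricci_self_eq_sum {ι : Type*} [Fintype ι] (x : M) (u : TangentSpace I x)
    (e : OrthonormalBasis ι ℝ (TangentSpace I x)) :
    ricci I x u u = ∑ a, inner ℝ (curvature I x u (e a) (e a)) u := by
  rw [ricci_eq_sum x u u e]
  exact Finset.sum_congr rfl fun a _ ↦ inner_curvature_swap x _ _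

end Curvature

section Hypersurface

variable {V : (x : M) → TangentSpace J (φ x)}
  [FiniteDimensional ℝ E] [Bundle.RiemannianBundle (fun p : N ↦ TangentSpace J p)]

theorem inner_normalPart {ν : TangentSpace J (φ x)}
    (hν : ∀ w, inner ℝ ν (mfderiv I J φ x w) = 0) (w : TangentSpace J (φ x)) :
    inner ℝ (normalPart I J φ x w) ν = inner ℝ w ν := by
  have hmem : ν ∈ (mfderiv I J φ x).rangeᗮ := by
    rw [Submodule.mem_orthogonal']
    rintro _ ⟨u, rfl⟩
    exact hν u
  rw [normalPart, Submodule.inner_starProjection_left_eq_right,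
    Submodule.starProjection_eq_self_iff.2 hmem]

variable [FiniteDimensional ℝ F] [Bundle.RiemannianBundle (fun x : M ↦ TangentSpace I x)]

theorem exists_orthonormalBasis_cons_mfderiv (hφ : IsIsometricImmersion I J φ)
    (hdim : finrank ℝ F = finrank ℝ E + 1) {n : TangentSpace J (φ x)} (hn : ‖n‖ = 1)
    (hnormal : ∀ w, inner ℝ n (mfderiv I J φ x w) = 0) :
    ∃ b : OrthonormalBasis (Fin (finrank ℝ (TangentSpace I x) + 1)) ℝ (TangentSpace J (φ x)),
      b 0 = n ∧
        ∀ i, b (Fin.succ i) = mfderiv I J φ x (stdOrthonormalBasis ℝ (TangentSpace I x) i) := by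
  set e := stdOrthonormalBasis ℝ (TangentSpace I x)
  have hframe : Orthonormal ℝ (Matrix.vecCons n fun i ↦ mfderiv I J φ x (e i)) := by
    classical
    refine orthonormal_vecCons_iff.2 ⟨hn, fun i ↦ hnormal _, orthonormal_iff_ite.2 fun i j ↦ ?_⟩
    rw [hφ.inner_mfderiv, orthonormal_iff_ite.1 e.orthonormal]
  obtain ⟨b, hb⟩ :=
    (hframe.comp _ Subtype.val_injective).exists_orthonormalBasis_extension_of_card_eq
      (s := Set.univ) (hdim.trans (Fintype.card_fin _).symm)
  exact ⟨b, hb 0 trivial, fun i ↦ hb i.succ trivial⟩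

variable [IsManifold J ∞ N] [J.Boundaryless]
  [IsContMDiffRiemannianBundle J ∞ F (fun x : N ↦ TangentSpace J x)]

theorem inner_curvatureTrace (hφ : IsIsometricImmersion I J φ)
    (hdim : finrank ℝ F = finrank ℝ E + 1)
    (hnormal : ∀ w, inner ℝ (V x) (mfderiv I J φ x w) = 0) :
    inner ℝ (curvatureTrace I J φ V x) (V x) = ricci J (φ x) (V x) (V x) := by
  rcases eq_or_ne (V x) 0 with hzero | hne
  · simp only [ricci_self_eq_sum (φ x) _ (stdOrthonormalBasis ℝ (TangentSpace J (φ x))), hzero,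
      inner_zero_right, Finset.sum_const_zero]
  obtain ⟨b, hb₀, hb⟩ := exists_orthonormalBasis_cons_mfderiv hφ hdim
    (n := ‖V x‖⁻¹ • V x) (norm_smul_inv_norm hne) fun w ↦ by
      rw [real_inner_smul_left, hnormal, mul_zero]
  have hVx : V x = ‖V x‖ • b 0 := by rw [hb₀, smul_inv_smul₀ (norm_ne_zero_iff.2 hne)]
  have hzero : inner ℝ (curvature J (φ x) (V x) (b 0) (b 0)) (V x) = 0 := by
    rw [hVx, real_inner_smul_right, inner_curvature_self_right, mul_zero]
  rw [ricci_self_eq_sum (φ x) (V x) b, Fin.sum_univ_succ, hzero, zero_add, curvatureTrace,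
    sum_inner]
  simp only [hb]

end Hypersurface

section Biminimal

variable [FiniteDimensional ℝ E] [IsManifold I ∞ M] [I.Boundaryless]
  [Bundle.RiemannianBundle (fun x : M ↦ TangentSpace I x)]
  [IsContMDiffRiemannianBundle I ∞ E (fun x : M ↦ TangentSpace I x)]
  [FiniteDimensional ℝ F] [IsManifold J ∞ N] [J.Boundaryless]
  [Bundle.RiemannianBundle (fun p : N ↦ TangentSpace J p)]
  [IsContMDiffRiemannianBundle J ∞ F (fun p : N ↦ TangentSpace J p)]
  {lam : ℝ}

theorem inner_roughLaplacian_meanCurvature (hφ : IsBiminimal I J φ lam) (x : M) :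
    inner ℝ (roughLaplacian I J φ (meanCurvature I J φ) x) (meanCurvature I J φ x)
      = lam * ‖meanCurvature I J φ x‖ ^ 2
        - inner ℝ (curvatureTrace I J φ (meanCurvature I J φ) x) (meanCurvature I J φ x) := by
  have hzero := congrArg (inner ℝ · (meanCurvature I J φ x)) (hφ.eq_zero x)
  simp only [inner_add_left, inner_zero_left, real_inner_smul_left, real_inner_self_eq_norm_sq,
    inner_normalPart (inner_meanCurvature_mfderiv hφ.toIsIsometricImmersion x), inner_sub_left,
    inner_neg_left] at hzero
  linarith

theorem le_laplacian_norm_sq_meanCurvature (hφ : IsBiminimal I J φ lam) (x : M) :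
    2 * finrank ℝ E * ‖meanCurvature I J φ x‖ ^ 4 + 2 * lam * ‖meanCurvature I J φ x‖ ^ 2
        - 2 * inner ℝ (curvatureTrace I J φ (meanCurvature I J φ) x) (meanCurvature I J φ x)
      ≤ laplacian I (fun p ↦ ‖meanCurvature I J φ p‖ ^ 2) x := by
  have hsmooth := contDiffAt_sectionInCharts_meanCurvature hφ.contMDiff x
  rw [laplacian_norm_sq (hφ.contMDiff x) (hsmooth.of_le (by norm_cast)),
    inner_roughLaplacian_meanCurvature hφ]
  linarith [finrank_mul_norm_meanCurvature_pow_four_le hφ.toIsIsometricImmersion x]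

end Biminimal

end Riem

theorem lemma5p1_general {E : Type*} [NormedAddCommGroup E] [NormedSpace ℝ E]
    [FiniteDimensional ℝ E]
    {H : Type*} [TopologicalSpace H] {I : ModelWithCorners ℝ E H} [I.Boundaryless]
    {M : Type*} [TopologicalSpace M] [ChartedSpace H M] [IsManifold I ∞ M]
    [Bundle.RiemannianBundle (fun x : M ↦ TangentSpace I x)]
    [IsContMDiffRiemannianBundle I ∞ E (fun x : M ↦ TangentSpace I x)]
    {F : Type*} [NormedAddCommGroup F] [NormedSpace ℝ F] [FiniteDimensional ℝ F]
    {H' : Type*} [TopologicalSpace H'] {J : ModelWithCorners ℝ F H'} [J.Boundaryless]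
    {N : Type*} [TopologicalSpace N] [ChartedSpace H' N] [IsManifold J ∞ N]
    [Bundle.RiemannianBundle (fun p : N ↦ TangentSpace J p)]
    [IsContMDiffRiemannianBundle J ∞ F (fun p : N ↦ TangentSpace J p)]
    (hdim : Module.finrank ℝ F = Module.finrank ℝ E + 1)
    {φ : M → N} {lam : ℝ} (hφ : Riem.IsBiminimal I J φ lam) :
    ContMDiff I 𝓘(ℝ, ℝ) ∞ (fun x ↦ ‖Riem.meanCurvature I J φ x‖ ^ 2) ∧
    ∀ x : M,
      Riem.laplacian I (fun y ↦ ‖Riem.meanCurvature I J φ y‖ ^ 2) x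
        ≥ 2 * Module.finrank ℝ E * ‖Riem.meanCurvature I J φ x‖ ^ 4
          + 2 * lam * ‖Riem.meanCurvature I J φ x‖ ^ 2
          - 2 * Riem.ricci J (φ x) (Riem.meanCurvature I J φ x) (Riem.meanCurvature I J φ x) := by
  refine ⟨fun x ↦ Riem.contMDiffAt_norm_sq (hφ.contMDiff x)
    (Riem.contDiffAt_sectionInCharts_meanCurvature hφ.contMDiff x), fun x ↦ ?_⟩
  rw [← Riem.inner_curvatureTrace hφ.toIsIsometricImmersion hdim
    (Riem.inner_meanCurvature_mfderiv hφ.toIsIsometricImmersion x)]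
  exact Riem.le_laplacian_norm_sq_meanCurvature hφ x

theorem lemma5p1 {m : ℕ}
    {M : Type*} [TopologicalSpace M] [T2Space M] [SecondCountableTopology M]
    [ChartedSpace (EuclideanSpace ℝ (Fin m)) M] [IsManifold (𝓡 m) ∞ M]
    [Bundle.RiemannianBundle (fun x : M ↦ TangentSpace (𝓡 m) x)]
    [IsContMDiffRiemannianBundle (𝓡 m) ∞ (EuclideanSpace ℝ (Fin m))
      (fun x : M ↦ TangentSpace (𝓡 m) x)]
    {N : Type*} [TopologicalSpace N] [T2Space N] [SecondCountableTopology N]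
    [ChartedSpace (EuclideanSpace ℝ (Fin (m + 1))) N] [IsManifold (𝓡 (m + 1)) ∞ N]
    [Bundle.RiemannianBundle (fun p : N ↦ TangentSpace (𝓡 (m + 1)) p)]
    [IsContMDiffRiemannianBundle (𝓡 (m + 1)) ∞ (EuclideanSpace ℝ (Fin (m + 1)))
      (fun p : N ↦ TangentSpace (𝓡 (m + 1)) p)]
    (hRic : Riem.RicciNonpos (𝓡 (m + 1)) N)
    (φ : M → N) (lam : ℝ) (hlam : 0 ≤ lam)
    (hφ : Riem.IsBiminimal (𝓡 m) (𝓡 (m + 1)) φ lam) :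
    ContMDiff (𝓡 m) 𝓘(ℝ, ℝ) ∞ (fun x ↦ ‖Riem.meanCurvature (𝓡 m) (𝓡 (m + 1)) φ x‖ ^ 2) ∧
    ∀ x : M,
      Riem.laplacian (𝓡 m) (fun y ↦ ‖Riem.meanCurvature (𝓡 m) (𝓡 (m + 1)) φ y‖ ^ 2) x
        ≥ 2 * m * ‖Riem.meanCurvature (𝓡 m) (𝓡 (m + 1)) φ x‖ ^ 4 := by
  obtain ⟨hsmooth, hlap⟩ := lemma5p1_general (by simp) hφ
  refine ⟨hsmooth, fun x ↦ ?_⟩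
  have hbochner := hlap x
  rw [finrank_euclideanSpace_fin] at hbochner
  linarith [hRic (φ x) (Riem.meanCurvature (𝓡 m) (𝓡 (m + 1)) φ x),
    mul_nonneg hlam (sq_nonneg ‖Riem.meanCurvature (𝓡 m) (𝓡 (m + 1)) φ x‖)]
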